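/- There is a universal constant $C > 0$ with the following property. Let $\Gamma$ be a symmetric real random variable with $\mathbb{E}\,\Gamma^6 < \infty$ such that the (real-valued, even) function $\gamma(\xi) = \mathbb{E} \exp(-i\xi\Gamma)$ satisfies $\gamma(\xi) = 0$ for $|\xi| \ge 1$ and $1 - 1000\,\xi^2 \le \gamma(\xi) \le 1$ for all $\xi \in \mathbb{R}$. Let $\Delta_1, \ldots, \Delta_n$ be independent symmetric Bernoulli random variables, i.e. $\mathbb{P}(\Delta_i = 1) = \mathbb{P}(\Delta_i = -1) = 1/2$, and suppose that $\Gamma$ is independent of $(\Delta_1, \ldots, \Delta_n)$. Let $0 \ne \theta = (\theta_1, \ldots, \theta_n) \in \mathbb{R}^n$ and $\sigma > 0$ satisfy $$ \sum_{i\,;\, |\theta_i| \ge \sigma} \theta_i^2 \le \frac12 |\theta|^2, $$ where $|\cdot|$ is the Euclidean norm. Then, for every $t \in \mathbb{R}$, $$ \left| \mathbb{P}\left( \sigma \Gamma + \sum_{i=1}^n \theta_i \Delta_i \ge t \right) - \Phi\left( \frac{t}{|\theta|} \right) \right| \le C \left( \frac{\sigma^2}{|\theta|^2} + \sum_{i=1}^n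 \frac{\theta_i^4}{|\theta|^4} \right), $$ where $\Phi(t) = \frac{1}{\sqrt{2\pi}} \int_t^\infty e^{-s^2/2}\, ds$. -/

import Mathlib

open MeasureTheory ProbabilityTheory

/-- The standard Gaussian density `φ(s) = (2π)^{-1/2} exp(-s²/2)`. -/
noncomputable def gaussDensity (s : ℝ) : ℝ :=
  1 / Real.sqrt (2 * Real.pi) * Real.exp (-s ^ 2 / 2)

/-- The upper tail `Φ(t) = ∫_t^∞ φ(s) ds` of the standard Gaussian law. -/
noncomputable def gaussTail (t : ℝ) : ℝ :=
  ∫ s in Set.Ioi t, gaussDensity s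

/-- The function `γ(ξ) = 𝔼 exp(-i ξ Γ)`. -/
noncomputable def fourierOf {Ω : Type*} [MeasurableSpace Ω] (P : Measure Ω)
    (Γ : Ω → ℝ) (ξ : ℝ) : ℂ :=
  ∫ ω, Complex.exp (-(Complex.I * (ξ : ℂ) * (Γ ω : ℂ))) ∂P

/-- `Γ` is an admissible smoothing variable. As `Γ` is symmetric, `γ` is real-valued, so the
two-sided bound on `γ` is expressed through its real part. -/
structure IsSmoothingVariable {Ω : Type*} [MeasurableSpace Ω] (P : Measure Ω)
    (Γ : Ω → ℝ) : Prop where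
  measurable : Measurable Γ
  symmetric : IdentDistrib Γ (fun ω => -Γ ω) P P
  integrable_pow_six : Integrable (fun ω => Γ ω ^ 6) P
  fourier_eq_zero : ∀ ξ : ℝ, 1 ≤ |ξ| → fourierOf P Γ ξ = 0
  le_fourier : ∀ ξ : ℝ, 1 - 1000 * ξ ^ 2 ≤ (fourierOf P Γ ξ).re
  fourier_le : ∀ ξ : ℝ, (fourierOf P Γ ξ).re ≤ 1

/-- `Δ` is a symmetric Bernoulli (Rademacher) variable. -/
structure IsSymmetricBernoulli {Ω : Type*} [MeasurableSpace Ω] (P : Measure Ω)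
    (Δ : Ω → ℝ) : Prop where
  measurable : Measurable Δ
  prob_one : P {ω | Δ ω = 1} = 1 / 2
  prob_neg_one : P {ω | Δ ω = -1} = 1 / 2

/-!
For a probability measure `μ` on `ℝ`, the increment `x ↦ μ (x - r, x]` is the convolution of `μ`
with the indicator of `[0, r)`. It is therefore integrable, and its Fourier transform is the
characteristic function of `μ` times a factor of modulus at most `(π |w|)⁻¹` whatever `r` is.
Inverting the Fourier transform of the difference of two such increments and letting `r → ∞` bounds
the difference of the distribution functions by `π⁻¹ ∫ |μ̂ ξ - ν̂ ξ| / |ξ| dξ`.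

For `X = σ Γ + ∑ θ i Δ i` the characteristic function is `γ (σ ξ) ∏ cos (θ i ξ)`. Frequencies with
`|σ ξ| ≥ 1` are removed by `γ`. When `|σ ξ| < 1`, every coordinate with `|θ i ξ| > 1` has
`|θ i| ≥ σ`, so by hypothesis the coordinates with `|θ i ξ| ≤ 1`, where
`|cos x| ≤ exp (-x² / 4)`, carry at least half of `|θ|²`: the product is at most
`exp (-|θ|² ξ² / 8)` and is close to `exp (-|θ|² ξ² / 2)` with that weight.
-/

open Filter Set Topology FourierTransform
open scoped Real NNReal RealInnerProductSpace

lemma integrable_uncurry_neg_add {G E : Type*} [AddGroup G] [MeasurableSpace G] [MeasurableAdd₂ G]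
    [MeasurableNeg G] [NormedAddCommGroup E] {ν : Measure G} [SFinite ν] [ν.IsAddLeftInvariant]
    {f : G → E} (hf : Integrable f ν) (μ : Measure G) [IsFiniteMeasure μ] :
    Integrable (Function.uncurry fun y x => f (-y + x)) (μ.prod ν) :=
  (measurePreserving_prod_neg_add μ ν).integrable_comp_of_integrable (hf.comp_snd μ)

section Fourier

variable {V E : Type*} [NormedAddCommGroup V] [InnerProductSpace ℝ V] [FiniteDimensional ℝ V]
  [MeasurableSpace V] [BorelSpace V] [NormedAddCommGroup E] [NormedSpace ℂ E]

lemma norm_le_integral_of_norm_fourier_le [CompleteSpace E] {f : V → E} {k : V → ℝ}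
    (hf : Integrable f) (hk : Integrable k) (hfk : ∀ᵐ w, ‖𝓕 f w‖ ≤ k w) {x : V}
    (hx : ContinuousAt f x) : ‖f x‖ ≤ ∫ w, k w := by
  have hcont : Continuous (𝓕 f) :=
    VectorFourier.fourierIntegral_continuous Real.continuous_fourierChar continuous_inner hf
  have hint : Integrable (𝓕 f) := hk.mono' hcont.aestronglyMeasurable hfk
  rw [← hf.fourierInv_fourier_eq hint hx, Real.fourierInv_eq]
  exact norm_integral_le_of_norm_le hk (hfk.mono fun w hw => by rwa [Circle.norm_smul])

lemma fourier_sub_apply {f g : V → E} (hf : Integrable f) (hg : Integrable g) (w : V) :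
    𝓕 (fun x => f x - g x) w = 𝓕 f w - 𝓕 g w := by
  simp_rw [Real.fourier_eq, smul_sub]
  exact integral_sub ((Real.fourierIntegral_convergent_iff w).2 hf)
    ((Real.fourierIntegral_convergent_iff w).2 hg)

lemma fourier_integral_neg_add [CompleteSpace E] {f : V → E} (hf : Integrable f) (μ : Measure V)
    [IsFiniteMeasure μ] (w : V) :
    𝓕 (fun x => ∫ y, f (-y + x) ∂μ) w = charFun μ (-(2 * π) • w) • 𝓕 f w := by
  have hsmul : Integrable (Function.uncurry fun y x => 𝐞 (-⟪x, w⟫) • f (-y + x))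
      (μ.prod volume) := by
    have hadd := integrable_uncurry_neg_add hf μ
    refine hadd.norm.mono' (.smul (by fun_prop) hadd.aestronglyMeasurable) (.of_forall fun p => ?_)
    simp [Function.uncurry, Circle.norm_smul]
  have htrans (y : V) : ∫ x, 𝐞 (-⟪x, w⟫) • f (-y + x) = 𝐞 (-⟪y, w⟫) • 𝓕 f w := by
    simpa [VectorFourier.fourierIntegral, Function.comp_def, add_comm, Real.fourier_eq] using
      congrFun (VectorFourier.fourierIntegral_comp_add_right 𝐞 volume (innerₗ V) f (-y)) w
  calc 𝓕 (fun x => ∫ y, f (-y + x) ∂μ) w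
      = ∫ x, ∫ y, 𝐞 (-⟪x, w⟫) • f (-y + x) ∂μ := by
        simp_rw [Real.fourier_eq, Circle.smul_def, integral_smul]
    _ = ∫ y, (𝐞 (-⟪y, w⟫) : ℂ) • 𝓕 f w ∂μ := by
        rw [← integral_integral_swap hsmul]
        simp_rw [htrans, Circle.smul_def]
    _ = charFun μ (-(2 * π) • w) • 𝓕 f w := by
        rw [integral_smul_const, charFun_apply]
        simp [Real.fourierChar_apply, real_inner_smul_right]

end Fourier

lemma norm_fourier_indicator_Ico_le {r : ℝ} (hr : 0 ≤ r) {w : ℝ} (hw : w ≠ 0) :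
    ‖𝓕 ((Ico 0 r).indicator fun _ => (1 : ℂ)) w‖ ≤ (π * |w|)⁻¹ := by
  set c : ℂ := -2 * π * w * Complex.I with hc
  have hc0 : c ≠ 0 := by simp [hc, hw, Real.pi_ne_zero]
  have hnorm : ‖c‖ = 2 * (π * |w|) := by simp [hc, abs_of_pos Real.pi_pos, mul_assoc]
  have heq : 𝓕 ((Ico 0 r).indicator fun _ => (1 : ℂ)) w = (Complex.exp (c * r) - 1) / c := by
    calc 𝓕 ((Ico 0 r).indicator fun _ => (1 : ℂ)) w
        = ∫ x, (Ico 0 r).indicator (fun x : ℝ => Complex.exp (c * x)) x := by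
          rw [Real.fourier_real_eq_integral_exp_smul]
          congr 1 with x
          by_cases hx : x ∈ Ico 0 r
          · simp only [indicator_of_mem hx, hc, smul_eq_mul, mul_one]
            push_cast
            ring_nf
          · simp [indicator_of_notMem hx]
      _ = ∫ x in (0 : ℝ)..r, Complex.exp (c * x) := by
          rw [integral_indicator measurableSet_Ico, integral_Ico_eq_integral_Ioc,
            intervalIntegral.integral_of_le hr]
      _ = (Complex.exp (c * r) - 1) / c := by simp [integral_exp_mul_complex hc0]
  have hexp : ‖Complex.exp (c * r)‖ = 1 := by simp [Complex.norm_exp, hc]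
  rw [heq, norm_div, hnorm, div_le_iff₀ (by positivity)]
  calc ‖Complex.exp (c * r) - 1‖ ≤ ‖Complex.exp (c * r)‖ + ‖(1 : ℂ)‖ := norm_sub_le _ _
    _ = (π * |w|)⁻¹ * (2 * (π * |w|)) := by
      rw [hexp, norm_one]
      field_simp
      norm_num

lemma cdf_sub_cdf_eq_integral (μ : Measure ℝ) [IsProbabilityMeasure μ] {r : ℝ} (hr : 0 ≤ r)
    (x : ℝ) :
    ((cdf μ x - cdf μ (x - r) : ℝ) : ℂ) =
      ∫ y, (Ico 0 r).indicator (fun _ => (1 : ℂ)) (-y + x) ∂μ := by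
  have hset : (fun y => (Ico 0 r).indicator (fun _ => (1 : ℂ)) (-y + x)) =
      (Ioc (x - r) x).indicator fun _ => 1 := by
    ext y
    simp only [indicator_apply, mem_Ico, mem_Ioc]
    grind
  rw [hset, integral_indicator_const _ measurableSet_Ioc, cdf_eq_real, cdf_eq_real,
    ← measureReal_sdiff (Iic_subset_Iic.2 (by linarith)) measurableSet_Iic, Iic_sdiff_Iic,
    Complex.real_smul, mul_one]

lemma le_of_forall_notMem_countable {f : ℝ → ℝ} {s : Set ℝ} {x b : ℝ} (hs : s.Countable)
    (hf : ContinuousWithinAt f (Ioi x) x) (hb : ∀ y ∉ s, f y ≤ b) : f x ≤ b := by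
  refine le_of_tendsto_of_frequently hf fun hev => ?_
  obtain ⟨u, hu, hsub⟩ := mem_nhdsGT_iff_exists_Ioo_subset.1 hev
  have hus : Ioo x u ⊆ s := fun y hy => by_contra fun hys => hsub hy (hb y hys)
  exact (not_lt.2 (Cardinal.Real.Ioo_countable_iff.1 (hs.mono hus))) hu

lemma integrable_indicator_Ico (r : ℝ) :
    Integrable ((Ico 0 r).indicator fun _ => (1 : ℂ)) :=
  (integrable_indicator_iff measurableSet_Ico).2 (by simp)

lemma integrable_cdf_sub_cdf (μ : Measure ℝ) [IsProbabilityMeasure μ] {r : ℝ} (hr : 0 ≤ r) :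
    Integrable fun x => ((cdf μ x - cdf μ (x - r) : ℝ) : ℂ) := by
  simp_rw [cdf_sub_cdf_eq_integral μ hr]
  exact (integrable_uncurry_neg_add (integrable_indicator_Ico r) μ).integral_prod_right

lemma fourier_cdf_sub_cdf (μ : Measure ℝ) [IsProbabilityMeasure μ] {r : ℝ} (hr : 0 ≤ r) (w : ℝ) :
    𝓕 (fun x => ((cdf μ x - cdf μ (x - r) : ℝ) : ℂ)) w =
      charFun μ (-(2 * π) * w) * 𝓕 ((Ico 0 r).indicator fun _ => (1 : ℂ)) w := by
  simp_rw [cdf_sub_cdf_eq_integral μ hr]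
  exact fourier_integral_neg_add (integrable_indicator_Ico r) μ w

lemma countable_not_continuousAt_cdf_sub_cdf (μ : Measure ℝ) (r : ℝ) :
    {x | ¬ContinuousAt (fun x => cdf μ x - cdf μ (x - r)) x}.Countable := by
  have hcount := (monotone_cdf μ).countable_not_continuousAt
  refine (hcount.union (hcount.preimage (sub_left_injective (b := r)))).mono fun x hx => ?_
  by_contra! h
  simp only [mem_union, mem_preimage, mem_ofPred_eq, not_or, not_not] at h
  exact hx (h.1.sub (h.2.comp (f := fun x => x - r) (by fun_prop)))

lemma continuousWithinAt_cdf_sub_cdf (μ : Measure ℝ) (r x : ℝ) :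
    ContinuousWithinAt (fun x => cdf μ x - cdf μ (x - r)) (Ioi x) x :=
  ((cdf μ).right_continuous x |>.mono Ioi_subset_Ici_self).sub <|
    ((cdf μ).right_continuous (x - r)).comp (f := fun x => x - r) (by fun_prop)
      fun y hy => sub_le_sub_right (le_of_lt hy) r

lemma cdf_map_neg (ρ : Measure ℝ) [IsProbabilityMeasure ρ] (t : ℝ) :
    cdf (ρ.map Neg.neg) (-t) = ρ.real (Ici t) := by
  have : IsProbabilityMeasure (ρ.map Neg.neg) := Measure.isProbabilityMeasure_map (by fun_prop)
  rw [cdf_eq_real, map_measureReal_apply measurable_neg measurableSet_Iic]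
  congr 1 with x
  simp

lemma charFun_map_neg {E : Type*} [SeminormedAddCommGroup E] [InnerProductSpace ℝ E]
    [MeasurableSpace E] [BorelSpace E] (ρ : Measure E) (t : E) :
    charFun (ρ.map Neg.neg) t = charFun ρ (-t) := by
  simpa [Pi.neg_def] using charFun_map_smul (μ := ρ) (-1) t

section Smoothing

variable {μ ν : Measure ℝ} [IsProbabilityMeasure μ] [IsProbabilityMeasure ν] {k : ℝ → ℝ}

lemma norm_fourier_cdf_increment_sub_le
    (hk : ∀ ξ, ‖charFun μ ξ - charFun ν ξ‖ ≤ |ξ| * k ξ) {r : ℝ} (hr : 0 ≤ r)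
    {w : ℝ} (hw : w ≠ 0) :
    ‖𝓕 (fun x => ((cdf μ x - cdf μ (x - r) : ℝ) : ℂ) - (cdf ν x - cdf ν (x - r) : ℝ)) w‖ ≤
      2 * k (-(2 * π) * w) := by
  rw [fourier_sub_apply (integrable_cdf_sub_cdf μ hr) (integrable_cdf_sub_cdf ν hr),
    fourier_cdf_sub_cdf μ hr, fourier_cdf_sub_cdf ν hr, ← sub_mul, norm_mul]
  calc _ ≤ |-(2 * π) * w| * k (-(2 * π) * w) * (π * |w|)⁻¹ := by
        gcongr
        · exact (norm_nonneg _).trans (hk _)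
        · exact hk _
        · exact norm_fourier_indicator_Ico_le hr hw
    _ = 2 * k (-(2 * π) * w) := by
        rw [abs_mul, abs_neg, abs_of_pos Real.two_pi_pos]
        field_simp

lemma abs_cdf_increment_sub_le_integral_of_continuousAt (hkint : Integrable k)
    (hk : ∀ ξ, ‖charFun μ ξ - charFun ν ξ‖ ≤ |ξ| * k ξ) {r : ℝ} (hr : 0 ≤ r) {x : ℝ}
    (hμ : ContinuousAt (fun x => cdf μ x - cdf μ (x - r)) x)
    (hν : ContinuousAt (fun x => cdf ν x - cdf ν (x - r)) x) :
    |cdf μ x - cdf μ (x - r) - (cdf ν x - cdf ν (x - r))| ≤ π⁻¹ * ∫ ξ, k ξ := by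
  have hscale : Integrable fun w => 2 * k (-(2 * π) * w) :=
    (hkint.comp_mul_left' (by simp [Real.pi_ne_zero])).const_mul 2
  have hintegral : ∫ w, 2 * k (-(2 * π) * w) = π⁻¹ * ∫ ξ, k ξ := by
    rw [integral_const_mul, Measure.integral_comp_mul_left]
    simp only [mul_inv_rev, inv_neg, abs_neg, abs_mul, abs_inv, abs_of_pos Real.pi_pos, smul_eq_mul,
      Nat.abs_ofNat]
    ring
  rw [← hintegral, ← Real.norm_eq_abs, ← Complex.norm_real, Complex.ofReal_sub]
  exact norm_le_integral_of_norm_fourier_le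
    (f := fun y => ((cdf μ y - cdf μ (y - r) : ℝ) : ℂ) - (cdf ν y - cdf ν (y - r) : ℝ))
    ((integrable_cdf_sub_cdf μ hr).sub (integrable_cdf_sub_cdf ν hr)) hscale
    ((Measure.ae_ne volume 0).mono fun w hw => norm_fourier_cdf_increment_sub_le hk hr hw)
    ((Complex.continuous_ofReal.continuousAt.comp hμ).sub
      (Complex.continuous_ofReal.continuousAt.comp hν))

lemma abs_cdf_increment_sub_le_integral (hkint : Integrable k)
    (hk : ∀ ξ, ‖charFun μ ξ - charFun ν ξ‖ ≤ |ξ| * k ξ) {r : ℝ} (hr : 0 ≤ r) (x : ℝ) :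
    |cdf μ x - cdf μ (x - r) - (cdf ν x - cdf ν (x - r))| ≤ π⁻¹ * ∫ ξ, k ξ := by
  refine le_of_forall_notMem_countable
    (f := fun x => |cdf μ x - cdf μ (x - r) - (cdf ν x - cdf ν (x - r))|)
    ((countable_not_continuousAt_cdf_sub_cdf μ r).union
      (countable_not_continuousAt_cdf_sub_cdf ν r))
    ((continuousWithinAt_cdf_sub_cdf μ r x).sub (continuousWithinAt_cdf_sub_cdf ν r x)).abs
    fun y hy => ?_
  simp only [mem_union, mem_ofPred_eq, not_or, not_not] at hy
  exact abs_cdf_increment_sub_le_integral_of_continuousAt hkint hk hr hy.1 hy.2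

theorem abs_cdf_sub_cdf_le_integral (hkint : Integrable k)
    (hk : ∀ ξ, ‖charFun μ ξ - charFun ν ξ‖ ≤ |ξ| * k ξ) (x : ℝ) :
    |cdf μ x - cdf ν x| ≤ π⁻¹ * ∫ ξ, k ξ := by
  have hleft : Tendsto (fun r => x - r) atTop atBot := by
    simpa only [sub_eq_add_neg] using tendsto_atBot_add_const_left _ x tendsto_neg_atTop_atBot
  have hlim (ρ : Measure ℝ) : Tendsto (fun r => cdf ρ x - cdf ρ (x - r)) atTop (𝓝 (cdf ρ x)) := by
    simpa using ((tendsto_cdf_atBot ρ).comp hleft).const_sub (cdf ρ x)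
  exact le_of_tendsto ((hlim μ).sub (hlim ν)).abs <|
    (eventually_ge_atTop 0).mono fun r hr => abs_cdf_increment_sub_le_integral hkint hk hr x

theorem abs_measureReal_Ici_sub_le_integral (hkint : Integrable k)
    (hk : ∀ ξ, ‖charFun μ ξ - charFun ν ξ‖ ≤ |ξ| * k ξ) (t : ℝ) :
    |μ.real (Ici t) - ν.real (Ici t)| ≤ π⁻¹ * ∫ ξ, k ξ := by
  have (ρ : Measure ℝ) [IsProbabilityMeasure ρ] : IsProbabilityMeasure (ρ.map Neg.neg) :=
    Measure.isProbabilityMeasure_map (by fun_prop)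
  rw [← cdf_map_neg, ← cdf_map_neg, ← integral_neg_eq_self]
  refine abs_cdf_sub_cdf_le_integral hkint.comp_neg (fun ξ => ?_) (-t)
  simpa only [charFun_map_neg, abs_neg] using hk (-ξ)

end Smoothing

lemma norm_prod_sub_prod_le {ι R : Type*} [NormedCommRing R] [NormOneClass R] {s : Finset ι}
    {a b : ι → R} {d e : ι → ℝ} (ha : ∀ i ∈ s, ‖a i‖ ≤ e i) (hb : ∀ i ∈ s, ‖b i‖ ≤ e i)
    (hd : ∀ i ∈ s, ‖a i - b i‖ ≤ d i * e i) :
    ‖∏ i ∈ s, a i - ∏ i ∈ s, b i‖ ≤ (∑ i ∈ s, d i) * ∏ i ∈ s, e i := by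
  classical
  induction s using Finset.induction_on with
  | empty => simp
  | insert i s hi ih =>
    simp only [Finset.forall_mem_insert] at ha hb hd
    have hbs : ‖∏ i ∈ s, b i‖ ≤ ∏ i ∈ s, e i :=
      (Finset.norm_prod_le s b).trans (Finset.prod_le_prod (fun _ _ => norm_nonneg _) hb.2)
    rw [Finset.prod_insert hi, Finset.prod_insert hi, Finset.prod_insert hi, Finset.sum_insert hi]
    set A := ∏ i ∈ s, a i
    set B := ∏ i ∈ s, b i
    calc ‖a i * A - b i * B‖ = ‖a i * (A - B) + (a i - b i) * B‖ := by ring_nf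
      _ ≤ ‖a i‖ * ‖A - B‖ + ‖a i - b i‖ * ‖B‖ :=
        (norm_add_le _ _).trans (add_le_add (norm_mul_le _ _) (norm_mul_le _ _))
      _ ≤ e i * ((∑ i ∈ s, d i) * ∏ i ∈ s, e i) + d i * e i * ∏ i ∈ s, e i :=
        add_le_add
          (mul_le_mul ha.1 (ih ha.2 hb.2 hd.2) (norm_nonneg _) ((norm_nonneg _).trans ha.1))
          (mul_le_mul hd.1 hbs (norm_nonneg _) ((norm_nonneg _).trans hd.1))
      _ = (d i + ∑ i ∈ s, d i) * (e i * ∏ i ∈ s, e i) := by ring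

/-- A common bound for `|cos x|` and `exp (-x² / 2)`, which must be trivial for large `x`, where
`|cos x|` returns to `1`. -/
noncomputable def cosEnvelope (x : ℝ) : ℝ :=
  if |x| ≤ 1 then Real.exp (-(x ^ 2 / 4)) else 1

lemma abs_cos_le_cosEnvelope (x : ℝ) : |Real.cos x| ≤ cosEnvelope x := by
  rw [cosEnvelope]
  split_ifs with hx
  · have hsq : x ^ 2 ≤ 1 := (sq_le_one_iff_abs_le_one x).2 hx
    have hcos := abs_le.1 (Real.cos_bound hx)
    have hexp := Real.add_one_le_exp (-(x ^ 2 / 4))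
    rw [Even.pow_abs (by decide)] at hcos
    exact abs_le.2 ⟨by nlinarith, by nlinarith⟩
  · exact Real.abs_cos_le_one x

lemma exp_neg_sq_div_two_le_cosEnvelope (x : ℝ) : Real.exp (-(x ^ 2 / 2)) ≤ cosEnvelope x := by
  rw [cosEnvelope]
  split_ifs
  · exact Real.exp_le_exp.2 (by linarith [sq_nonneg x])
  · exact Real.exp_le_one_iff.2 (by linarith [sq_nonneg x])

lemma abs_cos_sub_exp_le (x : ℝ) :
    |Real.cos x - Real.exp (-(x ^ 2 / 2))| ≤ x ^ 4 * cosEnvelope x := by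
  rw [cosEnvelope]
  split_ifs with hx
  · have hsq : x ^ 2 ≤ 1 := (sq_le_one_iff_abs_le_one x).2 hx
    have hcos := abs_le.1 (Real.cos_bound hx)
    have hexp := abs_le.1 (Real.abs_exp_sub_one_sub_id_le (x := -(x ^ 2 / 2))
      (by rw [abs_neg, abs_of_nonneg (by positivity)]; linarith))
    rw [Even.pow_abs (by decide)] at hcos
    calc |Real.cos x - Real.exp (-(x ^ 2 / 2))| ≤ x ^ 4 * (3 / 4) :=
          abs_le.2 ⟨by nlinarith [sq_nonneg (x ^ 2)], by nlinarith [sq_nonneg (x ^ 2)]⟩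
      _ ≤ x ^ 4 * Real.exp (-(x ^ 2 / 4)) := by
          gcongr
          linarith [Real.add_one_le_exp (-(x ^ 2 / 4))]
  · have hsq : 1 ≤ x ^ 2 := (one_lt_sq_iff_one_lt_abs x).2 (not_le.1 hx) |>.le
    have hexp : Real.exp (-(x ^ 2 / 2)) ≤ 1 := Real.exp_le_one_iff.2 (by linarith)
    have hpos := Real.exp_pos (-(x ^ 2 / 2))
    have hcos := Real.one_sub_sq_div_two_le_cos (x := x)
    exact abs_le.2 ⟨by nlinarith, by nlinarith [Real.cos_le_one x]⟩

section CosineProducts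

variable {ι : Type*} [Fintype ι] {x : ι → ℝ}

lemma prod_cosEnvelope_le (hx : ∑ i with 1 < |x i|, x i ^ 2 ≤ 1 / 2 * ∑ i, x i ^ 2) :
    ∏ i, cosEnvelope (x i) ≤ Real.exp (-((∑ i, x i ^ 2) / 8)) := by
  have hsplit :=
    Finset.sum_filter_add_sum_filter_not Finset.univ (fun i => |x i| ≤ 1) fun i => x i ^ 2
  simp only [not_le] at hsplit
  calc ∏ i, cosEnvelope (x i) = Real.exp (-((∑ i with |x i| ≤ 1, x i ^ 2) / 4)) := by
        simp only [cosEnvelope]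
        rw [Finset.prod_ite, Finset.prod_const_one, mul_one, ← Real.exp_sum, Finset.sum_neg_distrib,
          Finset.sum_div]
    _ ≤ Real.exp (-((∑ i, x i ^ 2) / 8)) := Real.exp_le_exp.2 (by linarith)

lemma abs_prod_cos_le (hx : ∑ i with 1 < |x i|, x i ^ 2 ≤ 1 / 2 * ∑ i, x i ^ 2) :
    |∏ i, Real.cos (x i)| ≤ Real.exp (-((∑ i, x i ^ 2) / 8)) := by
  rw [Finset.abs_prod]
  exact (Finset.prod_le_prod (fun _ _ => abs_nonneg _) fun i _ => abs_cos_le_cosEnvelope _).trans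
    (prod_cosEnvelope_le hx)

lemma abs_prod_cos_sub_exp_le (hx : ∑ i with 1 < |x i|, x i ^ 2 ≤ 1 / 2 * ∑ i, x i ^ 2) :
    |∏ i, Real.cos (x i) - Real.exp (-((∑ i, x i ^ 2) / 2))| ≤
      (∑ i, x i ^ 4) * Real.exp (-((∑ i, x i ^ 2) / 8)) := by
  rw [Finset.sum_div, ← Finset.sum_neg_distrib, Real.exp_sum]
  calc _ ≤ (∑ i, x i ^ 4) * ∏ i, cosEnvelope (x i) :=
        norm_prod_sub_prod_le (R := ℝ) (fun i _ => abs_cos_le_cosEnvelope (x i))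
          (fun i _ => (Real.abs_exp _).trans_le (exp_neg_sq_div_two_le_cosEnvelope (x i)))
          fun i _ => abs_cos_sub_exp_le (x i)
    _ ≤ _ := by
        gcongr
        exact prod_cosEnvelope_le hx

end CosineProducts

section GaussianMoments

variable {b : ℝ}

lemma integrable_abs_pow_mul_exp_neg_mul_sq (hb : 0 < b) (n : ℕ) :
    Integrable fun ξ : ℝ => |ξ| ^ n * Real.exp (-b * ξ ^ 2) := by
  have hn : (-1 : ℝ) < n := neg_one_lt_zero.trans_le n.cast_nonneg
  simpa using (integrable_rpow_mul_exp_neg_mul_sq hb hn).norm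

lemma integral_abs_pow_mul_exp_neg_mul_sq (hb : 0 < b) (m : ℕ) :
    ∫ ξ : ℝ, |ξ| ^ (2 * m + 1) * Real.exp (-b * ξ ^ 2) = Nat.factorial m / b ^ (m + 1) := by
  have hexp : ((2 * m + 1 : ℕ) + 1 : ℝ) / 2 = m + 1 := by
    push_cast
    ring
  calc ∫ ξ : ℝ, |ξ| ^ (2 * m + 1) * Real.exp (-b * ξ ^ 2)
      = ∫ ξ : ℝ, |ξ| ^ (2 * m + 1) * Real.exp (-b * |ξ| ^ 2) := by simp only [sq_abs]
    _ = 2 * ∫ ξ in Ioi (0 : ℝ), ξ ^ ((2 * m + 1 : ℕ) : ℝ) * Real.exp (-b * ξ ^ (2 : ℝ)) := by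
        simp only [Real.rpow_natCast, Real.rpow_two]
        exact integral_comp_abs (f := fun ξ => ξ ^ (2 * m + 1) * Real.exp (-b * ξ ^ 2))
    _ = Nat.factorial m / b ^ (m + 1) := by
        rw [integral_rpow_mul_exp_neg_mul_rpow two_pos
          (neg_one_lt_zero.trans_le (Nat.cast_nonneg _)) hb, neg_div, hexp,
          Real.Gamma_nat_eq_factorial, Real.rpow_neg hb.le]
        norm_cast
        field_simp

theorem abs_measureReal_Ici_sub_le_of_exp_neg_mul_sq {μ ν : Measure ℝ} [IsProbabilityMeasure μ]
    [IsProbabilityMeasure ν] (hb : 0 < b) {A B : ℝ}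
    (h : ∀ ξ, ‖charFun μ ξ - charFun ν ξ‖ ≤ (A * ξ ^ 2 + B * ξ ^ 4) * Real.exp (-b * ξ ^ 2))
    (t : ℝ) : |μ.real (Ici t) - ν.real (Ici t)| ≤ π⁻¹ * (A / b + B / b ^ 2) := by
  let g (n : ℕ) (ξ : ℝ) : ℝ := |ξ| ^ n * Real.exp (-b * ξ ^ 2)
  have hg (n : ℕ) : Integrable (g n) := integrable_abs_pow_mul_exp_neg_mul_sq hb n
  have hbound (ξ : ℝ) : ‖charFun μ ξ - charFun ν ξ‖ ≤ |ξ| * (A * g 1 ξ + B * g 3 ξ) := by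
    refine (h ξ).trans_eq ?_
    simp only [g]
    rw [← sq_abs ξ, ← Even.pow_abs (by decide : Even 4) ξ]
    ring
  have hintegral : ∫ ξ, (A * g 1 ξ + B * g 3 ξ) = A / b + B / b ^ 2 := by
    rw [integral_add ((hg 1).const_mul _) ((hg 3).const_mul _), integral_const_mul,
      integral_const_mul, integral_abs_pow_mul_exp_neg_mul_sq hb 0,
      integral_abs_pow_mul_exp_neg_mul_sq hb 1]
    simp [div_eq_mul_inv]
  rw [← hintegral]
  exact abs_measureReal_Ici_sub_le_integral (((hg 1).const_mul A).add ((hg 3).const_mul B)) hbound t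

end GaussianMoments

lemma gaussTail_eq_gaussianReal (t : ℝ) : gaussTail t = (gaussianReal 0 1).real (Ici t) := by
  have hnonneg : 0 ≤ᵐ[volume.restrict (Ici t)] gaussianPDFReal 0 1 :=
    .of_forall (gaussianPDFReal_nonneg 0 1)
  rw [Measure.real, gaussianReal_apply_eq_integral 0 one_ne_zero,
    ENNReal.toReal_ofReal (integral_nonneg_of_ae hnonneg), gaussTail, integral_Ici_eq_integral_Ioi]
  congr 1 with x
  simp [gaussDensity, gaussianPDFReal]

lemma gaussTail_div_eq_gaussianReal {r : ℝ≥0} (hr : 0 < r) (t : ℝ) :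
    gaussTail (t / r) = (gaussianReal 0 (r ^ 2)).real (Ici t) := by
  have hmap : (gaussianReal 0 1).map (fun x : ℝ => r * x) = gaussianReal 0 (r ^ 2) := by
    rw [gaussianReal_map_const_mul, mul_zero, mul_one]
    congr 1
  rw [← hmap, map_measureReal_apply (by fun_prop) measurableSet_Ici, gaussTail_eq_gaussianReal]
  congr 1 with x
  simp [div_le_iff₀' (NNReal.coe_pos.2 hr)]

section CharacteristicFunctions

variable {Ω : Type*} [MeasurableSpace Ω] {P : Measure Ω} {Γ : Ω → ℝ}

lemma fourierOf_eq_charFun (hΓ : Measurable Γ) (ξ : ℝ) :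
    fourierOf P Γ ξ = charFun (P.map Γ) (-ξ) := by
  rw [charFun_apply_real, integral_map hΓ.aemeasurable (by fun_prop), fourierOf]
  congr 1 with ω
  congr 1
  push_cast
  ring

lemma IsSmoothingVariable.ofReal_re_fourierOf (h : IsSmoothingVariable P Γ) (ξ : ℝ) :
    ((fourierOf P Γ ξ).re : ℂ) = fourierOf P Γ ξ := by
  have heven : charFun (P.map Γ) (-ξ) = charFun (P.map Γ) ξ := by
    conv_rhs => rw [h.symmetric.map_eq, ← Function.comp_def Neg.neg,
      ← Measure.map_map measurable_neg h.measurable, charFun_map_neg]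
  rw [fourierOf_eq_charFun h.measurable, ← Complex.conj_eq_iff_re, ← charFun_neg, neg_neg, heven]

lemma IsSmoothingVariable.norm_fourierOf_sub_one_le (h : IsSmoothingVariable P Γ) (ξ : ℝ) :
    ‖fourierOf P Γ ξ - 1‖ ≤ 1000 * ξ ^ 2 := by
  rw [← h.ofReal_re_fourierOf, ← Complex.ofReal_one, ← Complex.ofReal_sub, Complex.norm_real,
    Real.norm_eq_abs, abs_sub_le_iff]
  exact ⟨(sub_nonpos.2 (h.fourier_le ξ)).trans (by positivity), by linarith [h.le_fourier ξ]⟩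

variable [IsProbabilityMeasure P]

lemma IsSymmetricBernoulli.ae_eq_or {D : Ω → ℝ} (h : IsSymmetricBernoulli P D) :
    ∀ᵐ ω ∂P, D ω = 1 ∨ D ω = -1 := by
  have hpos : MeasurableSet {ω | D ω = 1} := h.measurable (measurableSet_singleton 1)
  have hneg : MeasurableSet {ω | D ω = -1} := h.measurable (measurableSet_singleton (-1))
  have hdisj : Disjoint {ω | D ω = 1} {ω | D ω = -1} :=
    Set.disjoint_left.2 fun ω (hω : D ω = 1) (hω' : D ω = -1) => by linarith
  refine (prob_compl_eq_zero_iff (hpos.union hneg)).2 ?_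
  rw [measure_union hdisj hneg, h.prob_one, h.prob_neg_one, ENNReal.add_halves]

lemma IsSymmetricBernoulli.charFun_map {D : Ω → ℝ} (h : IsSymmetricBernoulli P D) (ξ : ℝ) :
    charFun (P.map D) ξ = (Real.cos ξ : ℂ) := by
  have hpos : MeasurableSet {ω | D ω = 1} := h.measurable (measurableSet_singleton 1)
  have hneg : MeasurableSet {ω | D ω = -1} := h.measurable (measurableSet_singleton (-1))
  have hae : (fun ω => Complex.exp (ξ * D ω * Complex.I)) =ᵐ[P] fun ω =>
      {ω | D ω = 1}.indicator (fun _ => Complex.exp (ξ * Complex.I)) ω +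
        {ω | D ω = -1}.indicator (fun _ => Complex.exp (-ξ * Complex.I)) ω := by
    filter_upwards [h.ae_eq_or] with ω hω
    rcases hω with hω | hω <;> norm_num [hω, indicator_apply]
  rw [charFun_apply_real, integral_map h.measurable.aemeasurable (by fun_prop),
    integral_congr_ae hae, integral_add ((integrable_const _).indicator hpos)
      ((integrable_const _).indicator hneg), integral_indicator_const _ hpos,
    integral_indicator_const _ hneg, Measure.real, Measure.real, h.prob_one, h.prob_neg_one,
    Complex.ofReal_cos, Complex.cos, Complex.real_smul, Complex.real_smul, ENNReal.toReal_div,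
    ENNReal.toReal_one, ENNReal.toReal_ofNat]
  push_cast
  ring

variable {ι : Type*} [Fintype ι] {Δ : ι → Ω → ℝ}

lemma charFun_map_add_sum_mul (hΓ : Measurable Γ) (hΔ : ∀ i, IsSymmetricBernoulli P (Δ i))
    (hind : iIndepFun Δ P) (hΓΔ : IndepFun Γ (fun ω i => Δ i ω) P) (θ : ι → ℝ) (σ ξ : ℝ) :
    charFun (P.map fun ω => σ * Γ ω + ∑ i, θ i * Δ i ω) ξ =
      charFun (P.map Γ) (σ * ξ) * (∏ i, Real.cos (θ i * ξ) : ℝ) := by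
  have hmeas (i : ι) : Measurable fun ω => θ i * Δ i ω := (hΔ i).measurable.const_mul _
  have hindep : IndepFun (fun ω => σ * Γ ω) (fun ω => ∑ i, θ i * Δ i ω) P :=
    hΓΔ.comp (φ := fun x => σ * x) (ψ := fun v : ι → ℝ => ∑ i, θ i * v i) (by fun_prop)
      (by fun_prop)
  have hiindep : iIndepFun (fun i ω => θ i * Δ i ω) P :=
    hind.comp (fun i x => θ i * x) fun i => by fun_prop
  have hsum : charFun (P.map fun ω => ∑ i, θ i * Δ i ω) ξ = ∏ i, (Real.cos (θ i * ξ) : ℂ) := by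
    rw [hiindep.charFun_map_fun_sum_eq_prod fun i => (hmeas i).aemeasurable, Finset.prod_apply]
    exact Finset.prod_congr rfl fun i _ => by
      rw [charFun_map_mul_comp (hΔ i).measurable.aemeasurable, (hΔ i).charFun_map]
  have hadd := hindep.charFun_map_add_eq_mul (hΓ.const_mul σ).aemeasurable
    (Finset.measurable_sum _ fun i _ => hmeas i).aemeasurable
  rw [Complex.ofReal_prod, ← hsum, ← charFun_map_mul_comp hΓ.aemeasurable]
  exact congrFun hadd ξ

end CharacteristicFunctions

lemma sum_sq_filter_one_lt_abs_mul_le {ι : Type*} [Fintype ι] {θ : ι → ℝ} {σ ξ : ℝ}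
    (hsmall : ∑ i with σ ≤ |θ i|, θ i ^ 2 ≤ 1 / 2 * ∑ i, θ i ^ 2) (hξ : |σ * ξ| < 1) :
    ∑ i with 1 < |θ i * ξ|, (θ i * ξ) ^ 2 ≤ 1 / 2 * ∑ i, (θ i * ξ) ^ 2 := by
  have hsub (i : ι) (hi : 1 < |θ i * ξ|) : σ ≤ |θ i| := by
    by_contra! hlt
    have hle : |θ i * ξ| ≤ |σ * ξ| := by
      rw [abs_mul, abs_mul]
      exact mul_le_mul_of_nonneg_right (hlt.le.trans (le_abs_self σ)) (abs_nonneg ξ)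
    linarith
  simp_rw [mul_pow, ← Finset.sum_mul, ← mul_assoc]
  gcongr
  refine le_trans ?_ hsmall
  exact Finset.sum_le_sum_of_subset_of_nonneg (Finset.monotone_filter_right _ fun i _ => hsub i)
    fun i _ _ => sq_nonneg _

lemma norm_mul_prod_cos_sub_exp_le {ι : Type*} [Fintype ι] {φ : ℝ → ℂ} {K : ℝ}
    (hzero : ∀ η, 1 ≤ |η| → φ η = 0) (hquad : ∀ η, ‖φ η - 1‖ ≤ K * η ^ 2) {θ : ι → ℝ} {σ : ℝ}
    (hsmall : ∑ i with σ ≤ |θ i|, θ i ^ 2 ≤ 1 / 2 * ∑ i, θ i ^ 2) (ξ : ℝ) :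
    ‖φ (σ * ξ) * (∏ i, Real.cos (θ i * ξ) : ℝ) - Real.exp (-((∑ i, (θ i * ξ) ^ 2) / 2))‖ ≤
      (K * (σ * ξ) ^ 2 + ∑ i, (θ i * ξ) ^ 4) * Real.exp (-((∑ i, (θ i * ξ) ^ 2) / 8)) := by
  have hv : 0 ≤ ∑ i, (θ i * ξ) ^ 2 := Finset.sum_nonneg fun i _ => sq_nonneg _
  have hS : 0 ≤ ∑ i, (θ i * ξ) ^ 4 := Finset.sum_nonneg fun i _ => by positivity
  rcases le_or_gt 1 |σ * ξ| with hξ | hξ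
  · have hK : 1 ≤ K := by simpa [hzero 1 (by simp)] using hquad 1
    have hsq : 1 ≤ (σ * ξ) ^ 2 := (one_le_sq_iff_one_le_abs _).2 hξ
    rw [hzero _ hξ, zero_mul, zero_sub, norm_neg, Complex.norm_real, Real.norm_eq_abs,
      Real.abs_exp]
    calc Real.exp (-((∑ i, (θ i * ξ) ^ 2) / 2))
        ≤ 1 * Real.exp (-((∑ i, (θ i * ξ) ^ 2) / 8)) := by
          rw [one_mul]
          exact Real.exp_le_exp.2 (by linarith)
      _ ≤ _ := by
          gcongr
          nlinarith
  · have hsum := sum_sq_filter_one_lt_abs_mul_le hsmall hξ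
    set C := ∏ i, Real.cos (θ i * ξ)
    set G := Real.exp (-((∑ i, (θ i * ξ) ^ 2) / 2))
    calc ‖φ (σ * ξ) * C - G‖ = ‖(φ (σ * ξ) - 1) * C + (C - G : ℝ)‖ := by
          push_cast
          ring_nf
      _ ≤ ‖φ (σ * ξ) - 1‖ * |C| + |C - G| := by
          simpa only [norm_mul, Complex.norm_real, Real.norm_eq_abs] using
            norm_add_le ((φ (σ * ξ) - 1) * C) (C - G : ℝ)
      _ ≤ K * (σ * ξ) ^ 2 * Real.exp (-((∑ i, (θ i * ξ) ^ 2) / 8)) +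
          (∑ i, (θ i * ξ) ^ 4) * Real.exp (-((∑ i, (θ i * ξ) ^ 2) / 8)) := by
          gcongr
          · exact (norm_nonneg _).trans (hquad _)
          · exact hquad _
          · exact abs_prod_cos_le hsum
          · exact abs_prod_cos_sub_exp_le hsum
      _ = _ := by rw [add_mul]

section SmoothedSum

variable {Ω ι : Type*} [MeasurableSpace Ω] {P : Measure Ω} [IsProbabilityMeasure P] [Fintype ι]
  {Γ : Ω → ℝ} {Δ : ι → Ω → ℝ} {K : ℝ}

lemma norm_charFun_map_sub_charFun_gaussianReal_le (hΓ : Measurable Γ)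
    (hzero : ∀ ξ, 1 ≤ |ξ| → fourierOf P Γ ξ = 0) (hquad : ∀ ξ, ‖fourierOf P Γ ξ - 1‖ ≤ K * ξ ^ 2)
    (hΔ : ∀ i, IsSymmetricBernoulli P (Δ i)) (hind : iIndepFun Δ P)
    (hΓΔ : IndepFun Γ (fun ω i => Δ i ω) P) {θ : EuclideanSpace ℝ ι} {σ : ℝ}
    (hsmall : ∑ i with σ ≤ |θ i|, θ i ^ 2 ≤ 1 / 2 * ‖θ‖ ^ 2) (ξ : ℝ) :
    ‖charFun (P.map fun ω => σ * Γ ω + ∑ i, θ i * Δ i ω) ξ -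
        charFun (gaussianReal 0 (‖θ‖₊ ^ 2)) ξ‖ ≤
      (K * σ ^ 2 * ξ ^ 2 + (∑ i, θ i ^ 4) * ξ ^ 4) * Real.exp (-(‖θ‖ ^ 2 / 8) * ξ ^ 2) := by
  have hphi (η : ℝ) : charFun (P.map Γ) η = fourierOf P Γ (-η) := by
    rw [fourierOf_eq_charFun hΓ, neg_neg]
  have hnorm : ∑ i, (θ i * ξ) ^ 2 = ‖θ‖ ^ 2 * ξ ^ 2 := by
    simp_rw [EuclideanSpace.real_norm_sq_eq, mul_pow, Finset.sum_mul]
  have hgauss : charFun (gaussianReal 0 (‖θ‖₊ ^ 2)) ξ =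
      (Real.exp (-((∑ i, (θ i * ξ) ^ 2) / 2)) : ℂ) := by
    rw [charFun_gaussianReal, hnorm]
    push_cast
    simp
  rw [EuclideanSpace.real_norm_sq_eq] at hsmall
  rw [charFun_map_add_sum_mul hΓ hΔ hind hΓΔ, hgauss]
  refine (norm_mul_prod_cos_sub_exp_le (φ := charFun (P.map Γ))
    (fun η hη => by rw [hphi, hzero _ (by rwa [abs_neg])])
    (fun η => by simpa only [hphi, neg_sq] using hquad (-η)) hsmall ξ).trans_eq ?_
  simp_rw [hnorm, mul_pow (θ _), Finset.sum_mul]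
  ring_nf

theorem lemma6p1_general (hΓ : Measurable Γ)
    (hzero : ∀ ξ, 1 ≤ |ξ| → fourierOf P Γ ξ = 0) (hquad : ∀ ξ, ‖fourierOf P Γ ξ - 1‖ ≤ K * ξ ^ 2)
    (hΔ : ∀ i, IsSymmetricBernoulli P (Δ i)) (hind : iIndepFun Δ P)
    (hΓΔ : IndepFun Γ (fun ω i => Δ i ω) P) {θ : EuclideanSpace ℝ ι} {σ : ℝ} (hθ : θ ≠ 0)
    (hsmall : ∑ i with σ ≤ |θ i|, θ i ^ 2 ≤ 1 / 2 * ‖θ‖ ^ 2) (t : ℝ) :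
    |P.real {ω | t ≤ σ * Γ ω + ∑ i, θ i * Δ i ω} - gaussTail (t / ‖θ‖)| ≤
      8 / π * (K * (σ ^ 2 / ‖θ‖ ^ 2) + 8 * ∑ i, θ i ^ 4 / ‖θ‖ ^ 4) := by
  have hX : Measurable fun ω => σ * Γ ω + ∑ i, θ i * Δ i ω :=
    (hΓ.const_mul σ).add (Finset.measurable_sum _ fun i _ => (hΔ i).measurable.const_mul _)
  have := Measure.isProbabilityMeasure_map (μ := P) hX.aemeasurable
  have hb : 0 < ‖θ‖ ^ 2 / 8 := by positivity
  calc |P.real {ω | t ≤ σ * Γ ω + ∑ i, θ i * Δ i ω} - gaussTail (t / ‖θ‖)|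
      = |(P.map fun ω => σ * Γ ω + ∑ i, θ i * Δ i ω).real (Ici t) -
          (gaussianReal 0 (‖θ‖₊ ^ 2)).real (Ici t)| := by
        rw [map_measureReal_apply hX measurableSet_Ici,
          ← gaussTail_div_eq_gaussianReal (nnnorm_pos.2 hθ), coe_nnnorm]
        rfl
    _ ≤ π⁻¹ * (K * σ ^ 2 / (‖θ‖ ^ 2 / 8) + (∑ i, θ i ^ 4) / (‖θ‖ ^ 2 / 8) ^ 2) :=
        abs_measureReal_Ici_sub_le_of_exp_neg_mul_sq hb
          (norm_charFun_map_sub_charFun_gaussianReal_le hΓ hzero hquad hΔ hind hΓΔ hsmall) t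
    _ = 8 / π * (K * (σ ^ 2 / ‖θ‖ ^ 2) + 8 * ∑ i, θ i ^ 4 / ‖θ‖ ^ 4) := by
        rw [← Finset.sum_div]
        field_simp

end SmoothedSum

theorem lemma6p1 :
    ∃ C : ℝ, 0 < C ∧
      ∀ (Ω : Type*) [MeasurableSpace Ω] (P : Measure Ω) [IsProbabilityMeasure P]
        (n : ℕ) (Γ : Ω → ℝ) (Δ : Fin n → Ω → ℝ),
        IsSmoothingVariable P Γ →
        (∀ i, IsSymmetricBernoulli P (Δ i)) →
        iIndepFun Δ P →
        IndepFun Γ (fun ω i => Δ i ω) P →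
        ∀ (θ : EuclideanSpace ℝ (Fin n)) (σ : ℝ), θ ≠ 0 → 0 < σ →
          (∑ i with σ ≤ |θ i|, θ i ^ 2) ≤ 1 / 2 * ‖θ‖ ^ 2 →
          ∀ t : ℝ,
            |P.real {ω | t ≤ σ * Γ ω + ∑ i, θ i * Δ i ω} - gaussTail (t / ‖θ‖)| ≤
              C * (σ ^ 2 / ‖θ‖ ^ 2 + ∑ i, θ i ^ 4 / ‖θ‖ ^ 4) := by
  refine ⟨8 / π * 1000, by positivity, fun Ω _ P _ n Γ Δ hΓ hΔ hind hΓΔ θ σ hθ _ hsmall t => ?_⟩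
  refine (lemma6p1_general hΓ.measurable hΓ.fourier_eq_zero hΓ.norm_fourierOf_sub_one_le hΔ hind
    hΓΔ hθ hsmall t).trans ?_
  rw [mul_assoc, mul_add (1000 : ℝ)]
  gcongr
  norm_num
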